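/- Let $\Bbbk$ be a field, $S=\Bbbk[x_1,\ldots,x_n]$, and let $I\subseteq S$ be any monomial ideal, with set $G(I)$ of minimal monomial generators. For $F\subseteq G(I)$ let $m_F=\operatorname{lcm}(F)$. Say that a monomial $u=x^{\mathbf a}$ properly divides $v=x^{\mathbf b}$ if $u\neq v$, $u\mid v$, and $a_i<b_i$ for every $i$ with $b_i\neq 0$. The Buchberger complex $\mathrm{Bu}(I)$ is the simplicial complex on the vertex set $G(I)$ whose faces are the sets $F\subseteq G(I)$ such that no $u\in G(I)$ properly divides $m_F$. (1) If $I\neq 0$, then (the geometric realization of) $\mathrm{Bu}(I)$ is contractible. (2) $\mathrm{Bu}(I)$ supports a cellular resolution of $I$. That is, fix any linear order of $G(I)$; for $i\ge 0$ let $\mathcal F_i$ be the free $S$-module on the basis elements $e_F$ of multidegree $m_F$, where $F$ runs through the faces of $\mathrm{Bu}(I)$ with $i+1$ elements; and for $i\geq 1$ put $$d(e_F)=\sum_{v\in F}(-1)^{\#\{w\in F\,:\,w<v\}}\,\frac{m_F}{m_{F\setminus\{v\}}}\,e_{F\setminus\{v\}},\qquad \varepsilon(e_{\{v\}})=v .$$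 Then $$\cdots\to\mathcal F_2\xrightarrow{d}\mathcal F_1\xrightarrow{d}\mathcal F_0\xrightarrow{\varepsilon}I\to 0$$ is exact, and it is an $\mathbb N^n$-graded free resolution of $I$ over $S$. -/

import Mathlib

open MvPolynomial

/-- A monomial ideal of `k[x_1, …, x_n]`: an ideal generated by a set of monomials. -/
def IsMonomialIdeal {k : Type*} [Field k] {n : ℕ} (I : Ideal (MvPolynomial (Fin n) k)) : Prop :=
  ∃ A : Set (Fin n →₀ ℕ), I = Ideal.span ((fun a => monomial a (1 : k)) '' A)

/-- The exponent vectors of the minimal monomial generators of `I`, i.e. of the monomials in `I`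
that are minimal under divisibility. Monomials are identified with their exponent vectors
throughout: divisibility is the componentwise order `≤`, the least common multiple is the
supremum, and the monomial `1` is `0`. -/
def minGen {k : Type*} [Field k] {n : ℕ} (I : Ideal (MvPolynomial (Fin n) k)) :
    Set (Fin n →₀ ℕ) :=
  {a | Minimal (fun b => monomial b (1 : k) ∈ I) a}

instance minGen_finite {k : Type*} [Field k] {n : ℕ} (I : Ideal (MvPolynomial (Fin n) k)) :
    Finite (minGen I) := by
  have h : IsAntichain (· ≤ ·) (minGen I) := by
    intro a ha b hb hab hle
    exact hab (le_antisymm hle (hb.2 ha.1 hle))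
  exact (WellQuasiOrderedLE.finite_of_isAntichain h).to_subtype

/-- `x^a` properly divides `x^b`: it divides `x^b`, and `a_i < b_i` for every `i` with `b_i ≠ 0`.
The relation is strict; the clause `a ≠ b` only rules out that `1` properly divides `1`, since
`a = b ≠ 0` already violates the last clause. -/
def ProperlyDivides {n : ℕ} (a b : Fin n →₀ ℕ) : Prop :=
  a ≠ b ∧ a ≤ b ∧ ∀ i, b i ≠ 0 → a i < b i

/-- The label of a set `F` of labelled vertices: the least common multiple of the labels. -/
noncomputable def lcmLabel {V : Type*} {n : ℕ} (lab : V → (Fin n →₀ ℕ)) (F : Finset V) : Fin n →₀ ℕ :=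
  F.sup lab

/-- The Buchberger complex of `I`: its vertices are the minimal generators of `I`, and its faces
are the sets `F` of minimal generators such that no minimal generator properly divides `lcm F`.
(By the convention of `AbstractSimplicialComplex` only the nonempty faces are recorded.) -/
noncomputable def buchbergerComplex {k : Type*} [Field k] {n : ℕ} (I : Ideal (MvPolynomial (Fin n) k)) :
    AbstractSimplicialComplex (minGen I) where
  faces := {F | F.Nonempty ∧
    ∀ u ∈ minGen I, ¬ ProperlyDivides u (lcmLabel (fun v : minGen I => v.1) F)}
  isRelLowerSet_faces := by
    rintro F ⟨hF, h⟩
    refine ⟨hF, fun G hGF hG => ⟨hG, fun u hu hp => h u hu ?_⟩⟩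
    have hle : lcmLabel (fun v : minGen I => v.1) G ≤ lcmLabel (fun v : minGen I => v.1) F :=
      Finset.sup_mono hGF
    obtain ⟨h1, h2, h3⟩ := hp
    refine ⟨fun he => h1 (le_antisymm h2 (he ▸ hle)), h2.trans hle, fun i hi => ?_⟩
    by_cases h0 : lcmLabel (fun v : minGen I => v.1) G i = 0
    · have := h2 i
      omega
    · exact (h3 i h0).trans_le (hle i)
  singleton_mem := by
    intro v
    refine ⟨Finset.singleton_nonempty v, fun u hu hp => ?_⟩
    obtain ⟨h1, h2, -⟩ := hp
    simp only [lcmLabel, Finset.sup_singleton] at h1 h2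
    exact h1 (le_antisymm h2 (v.2.2 hu.1 h2))

/-- The geometric realization of a simplicial complex on a finite vertex set `V`: the points of
`ℝ^V` given by the barycentric coordinates that are supported on a face, with the subspace
topology. -/
def geometricRealization {V : Type*} [Finite V] (K : AbstractSimplicialComplex V) :
    Set (V → ℝ) :=
  {x | (∀ v, 0 ≤ x v) ∧ ∃ F ∈ K, (∀ v, v ∉ F → x v = 0) ∧ ∑ v ∈ F, x v = 1}

/-- The `i`-dimensional faces of `K`. -/
abbrev FaceOfDim {V : Type*} (K : AbstractSimplicialComplex V) (i : ℕ) : Type _ :=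
  {F : Finset V // F ∈ K ∧ F.card = i + 1}

open Classical in
/-- The face `F \ {v}` of a face `F` of positive dimension. -/
noncomputable def FaceOfDim.erase {V : Type*} {K : AbstractSimplicialComplex V} {i : ℕ}
    (F : FaceOfDim K (i + 1)) (v : V) (hv : v ∈ F.1) : FaceOfDim K i :=
  ⟨F.1.erase v, by
    have hc : (F.1.erase v).card = i + 1 := by
      rw [Finset.card_erase_of_mem hv, F.2.2]
      rfl
    exact ⟨(K.isRelLowerSet_faces F.2.1).2 (Finset.erase_subset v F.1)
      (Finset.card_pos.mp (by omega)), hc⟩⟩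

/-- The `i`-th module of the homogenized chain complex of `K` over `S = k[x_1, …, x_n]`: the free
`S`-module on the `i`-dimensional faces of `K`. -/
abbrev CellularModule (k : Type*) [Field k] (n : ℕ) {V : Type*} (K : AbstractSimplicialComplex V)
    (i : ℕ) : Type _ :=
  FaceOfDim K i →₀ MvPolynomial (Fin n) k

open Classical in
/-- The position of `v` in `F` (counted from `0`) with respect to a linear order of the
vertices. -/
noncomputable def vertexPosition {V : Type*} (ord : LinearOrder V) (F : Finset V) (v : V) : ℕ :=
  (F.filter (fun w => ord.lt w v)).card

/-- The homogenized simplicial differential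
`e_F ↦ ∑_{v ∈ F} ± x^(lcm F - lcm (F \ {v})) e_(F \ {v})`, where the sign of the summand is
`(-1)^(position of v in F)`. -/
noncomputable def cellularDifferential (k : Type*) [Field k] {n : ℕ} {V : Type*}
    (K : AbstractSimplicialComplex V) (lab : V → (Fin n →₀ ℕ)) (ord : LinearOrder V) (i : ℕ) :
    CellularModule k n K (i + 1) →ₗ[MvPolynomial (Fin n) k] CellularModule k n K i :=
  Finsupp.linearCombination (MvPolynomial (Fin n) k) fun F : FaceOfDim K (i + 1) =>
    ∑ v ∈ F.1.attach, Finsupp.single (F.erase v.1 v.2)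
      (monomial (lcmLabel lab F.1 - lcmLabel lab (F.erase v.1 v.2).1)
        ((-1 : k) ^ vertexPosition ord F.1 v.1))

/-- The augmentation `e_{v} ↦ x^(lab v)` of the homogenized chain complex, with values in `S`. -/
noncomputable def cellularAugmentation (k : Type*) [Field k] {n : ℕ} {V : Type*}
    (K : AbstractSimplicialComplex V) (lab : V → (Fin n →₀ ℕ)) :
    CellularModule k n K 0 →ₗ[MvPolynomial (Fin n) k] MvPolynomial (Fin n) k :=
  Finsupp.linearCombination (MvPolynomial (Fin n) k) fun F : FaceOfDim K 0 =>
    monomial (lcmLabel lab F.1) (1 : k)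

/-- The homogeneous component of multidegree `a` of the `i`-th module of the homogenized chain
complex, where `e_F` has the multidegree of `lcm F`. -/
def cellularGrading (k : Type*) [Field k] {n : ℕ} {V : Type*}
    (K : AbstractSimplicialComplex V) (lab : V → (Fin n →₀ ℕ)) (i : ℕ) (a : Fin n →₀ ℕ) :
    AddSubgroup (CellularModule k n K i) where
  carrier := {x | ∀ F : FaceOfDim K i, ∀ b, coeff b (x F) ≠ 0 → b + lcmLabel lab F.1 = a}
  zero_mem' := by
    intro F b hb
    simp at hb
  add_mem' := by
    intro x y hx hy F b hb
    by_cases h : coeff b (x F) = 0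
    · exact hy F b (fun h' => hb (by simp [h, h']))
    · exact hx F b h
  neg_mem' := by
    intro x hx F b hb
    exact hx F b (fun h => hb (by simp [h]))

/-- `⋯ → M 2 → M 1 → M 0 → I → 0` is an `ℕ^n`-graded free resolution of the ideal `I` of
`S = k[x_1, …, x_n]`. Here `grad i a` is the component of multidegree `a` of `M i`, `d i` is the
differential from `M (i + 1)` to `M i`, and `ε` is the augmentation `M 0 → I` followed by the
inclusion of `I` into `S`. -/
structure IsGradedFreeResolution {k : Type*} [Field k] {n : ℕ}
    (I : Ideal (MvPolynomial (Fin n) k)) (M : ℕ → Type*) [∀ i, AddCommGroup (M i)]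
    [∀ i, Module (MvPolynomial (Fin n) k) (M i)]
    (grad : ∀ i, (Fin n →₀ ℕ) → AddSubgroup (M i))
    (d : ∀ i, M (i + 1) →ₗ[MvPolynomial (Fin n) k] M i)
    (ε : M 0 →ₗ[MvPolynomial (Fin n) k] MvPolynomial (Fin n) k) : Prop where
  /-- Every `M i` is the direct sum of its homogeneous components, -/
  isInternal : ∀ i, DirectSum.IsInternal (grad i)
  /-- is a graded module over `S`, -/
  monomial_smul_mem : ∀ i a b (c : k), ∀ x ∈ grad i b, monomial a c • x ∈ grad i (a + b)
  /-- and has a basis of homogeneous elements. -/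
  free : ∀ i, ∃ B : Set (M i), (∀ x ∈ B, ∃ a, x ∈ grad i a) ∧
    LinearIndependent (MvPolynomial (Fin n) k) (fun x : B => (x : M i)) ∧
    Submodule.span (MvPolynomial (Fin n) k) B = ⊤
  /-- The differentials preserve multidegrees. -/
  d_mem : ∀ i a, ∀ x ∈ grad (i + 1) a, d i x ∈ grad i a
  /-- The augmentation preserves multidegrees. -/
  ε_mem : ∀ a, ∀ x ∈ grad 0 a, ∀ b, coeff b (ε x) ≠ 0 → b = a
  /-- Exactness at `M (i + 1)`, -/
  exact_succ : ∀ i, Function.Exact (d (i + 1)) (d i)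
  /-- at `M 0`, -/
  exact_zero : Function.Exact (d 0) ε
  /-- and at `I`. -/
  range_ε : LinearMap.range ε = I

/-- The simplicial complex `K` with vertex labels `lab` supports a cellular resolution of `I`: for
every orientation of `K` by a linear order of its vertices, the homogenized simplicial chain
complex of `K` is a graded free resolution of `I`. -/
def SupportsCellularResolution {k : Type*} [Field k] {n : ℕ} {V : Type*}
    (K : AbstractSimplicialComplex V) (lab : V → (Fin n →₀ ℕ))
    (I : Ideal (MvPolynomial (Fin n) k)) : Prop :=
  ∀ ord : LinearOrder V,
    IsGradedFreeResolution I (CellularModule k n K) (cellularGrading k K lab)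
      (cellularDifferential k K lab ord) (cellularAugmentation k K lab)

/-!
The starting point is that proper divisibility makes a vertex irrelevant to a least common
multiple: if the label of `u` properly divides `m`, then it attains none of the positive
coordinates of `m`, so inserting or removing the vertex `u` does not change whether a set of
vertices has least common multiple `m` (`lcmLabel_insert_eq_iff`). Hence the nonfaces of
the Buchberger complex with a fixed least common multiple are matched in pairs `F`, `F ∪ {u}`,
and the full simplex collapses onto the Buchberger complex, one least common multiple at a time.
The nonfaces are deleted in an order that makes the set `U` of deleted multidegrees an upper set
at each stage (`upperSet_label_induction`).

For contractibility, one stage only needs a continuous retraction, because a retract of a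
contractible space is contractible. If `m` is the least common multiple to be deleted, the
barycentric coordinates of the vertices other than `u` are lowered by `stoppingTime`, the smallest
amount for which some positive coordinate of `m` is no longer attained, and the mass set free goes
to `u` (`contractibleSpace_realizationOf`).

For the resolution, the strand of multidegree `b` of the homogenized chain complex is the augmented
simplicial chain complex over `k` of the faces whose least common multiple divides `x^b`
(`strand_cellularDifferential`, `coeff_cellularAugmentation`), so exactness follows from the
acyclicity of these subcomplexes whenever some generator divides `x^b`. The simplex on the
generators dividing `x^b` is a cone, and coning off with `u` the part of a chain on the faces to be
deleted shows that acyclicity survives each deletion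
(`exists_homologous_vanishing_of_toggle`, `exists_chainBoundary_eq`).
-/

/-! ### Least common multiples and proper divisibility -/

/-- The exponent vectors that some label properly divides. -/
def properMultiples {V : Type*} {n : ℕ} (lab : V → (Fin n →₀ ℕ)) : Set (Fin n →₀ ℕ) :=
  {m | ∃ u, ProperlyDivides (lab u) m}

lemma ProperlyDivides.mono {n : ℕ} {a b c : Fin n →₀ ℕ} (h : ProperlyDivides a b) (hbc : b ≤ c) :
    ProperlyDivides a c := by
  obtain ⟨h1, h2, h3⟩ := h
  refine ⟨fun he => h1 (le_antisymm h2 (he ▸ hbc)), h2.trans hbc, fun i hi => ?_⟩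
  have hb := h2 i
  have hc := hbc i
  by_cases h0 : b i = 0
  · omega
  · exact (h3 i h0).trans_le hc

lemma ProperlyDivides.ne_zero {n : ℕ} {a b : Fin n →₀ ℕ} (h : ProperlyDivides a b) : b ≠ 0 := by
  rintro rfl
  exact h.1 (le_antisymm h.2.1 (zero_le))

lemma isUpperSet_properMultiples {V : Type*} {n : ℕ} (lab : V → (Fin n →₀ ℕ)) :
    IsUpperSet (properMultiples lab) :=
  fun _ _ hab ⟨u, hu⟩ => ⟨u, hu.mono hab⟩

lemma lcmLabel_mono {V : Type*} {n : ℕ} (lab : V → (Fin n →₀ ℕ)) {F G : Finset V} (h : F ⊆ G) :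
    lcmLabel lab F ≤ lcmLabel lab G :=
  Finset.sup_mono h

lemma le_lcmLabel {V : Type*} {n : ℕ} (lab : V → (Fin n →₀ ℕ)) {F : Finset V} {v : V}
    (h : v ∈ F) : lab v ≤ lcmLabel lab F :=
  Finset.le_sup h

lemma lcmLabel_apply {V : Type*} {n : ℕ} (lab : V → (Fin n →₀ ℕ)) (F : Finset V) (i : Fin n) :
    lcmLabel lab F i = F.sup fun v => lab v i :=
  Finset.apply_sup_eq_sup_comp (fun a : Fin n →₀ ℕ => a i) (fun _ _ => rfl) rfl

/-- A vertex whose label properly divides `m` attains no positive coordinate of `m`, so that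
inserting it or removing it does not affect whether `m` is the least common multiple. -/
lemma lcmLabel_insert_eq_iff {V : Type*} [DecidableEq V] {n : ℕ} {lab : V → (Fin n →₀ ℕ)}
    {m : Fin n →₀ ℕ} {u : V} (hu : ProperlyDivides (lab u) m) (F : Finset V) :
    lcmLabel lab (insert u F) = m ↔ lcmLabel lab F = m := by
  have hins : lcmLabel lab (insert u F) = lab u ⊔ lcmLabel lab F := Finset.sup_insert
  refine ⟨fun h => ?_, fun h => by rw [hins, h, sup_eq_right]; exact hu.2.1⟩
  ext i
  have hi : max (lab u i) (lcmLabel lab F i) = m i := by rw [← h, hins]; rfl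
  by_cases h0 : m i = 0
  · omega
  · have := hu.2.2 i h0
    omega

/-- Induction along upper sets of labels: a property of the upper set `N` follows if it holds for
upper sets which contain no least common multiple, and if it may be transferred from
`U \ Iic m` to `U` for each least common multiple `m` that is minimal in `U`. -/
lemma upperSet_label_induction {V : Type*} [Finite V] {n : ℕ} (lab : V → (Fin n →₀ ℕ))
    {P : Set (Fin n →₀ ℕ) → Prop} (N : Set (Fin n →₀ ℕ)) (hN : IsUpperSet N)
    (base : ∀ U, (∀ F, lcmLabel lab F ∉ U) → P U)
    (step : ∀ U ⊆ N, IsUpperSet U → ∀ m ∈ U, (∀ F, lcmLabel lab F ∈ U → lcmLabel lab F ≤ m →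
      lcmLabel lab F = m) → P (U \ Set.Iic m) → P U) : P N := by
  suffices h : ∀ c : ℕ, ∀ U ⊆ N, IsUpperSet U → {F | lcmLabel lab F ∈ U}.ncard = c → P U from
    h _ N subset_rfl hN rfl
  intro c
  induction c using Nat.strong_induction_on with
  | _ c ih =>
    intro U hUN hU hc
    by_cases hne : ∃ F, lcmLabel lab F ∈ U
    · have hfin : (U ∩ Set.range (lcmLabel lab)).Finite :=
        (Set.finite_range _).subset Set.inter_subset_right
      obtain ⟨F₀, hF₀⟩ := hne
      obtain ⟨m, hm⟩ := hfin.exists_minimal ⟨_, hF₀, F₀, rfl⟩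
      refine step U hUN hU m hm.1.1 (fun F hF hle => ?_) (ih _ ?_ (U \ Set.Iic m)
        (Set.sdiff_subset.trans hUN) ?_ rfl)
      · exact le_antisymm hle (hm.2 ⟨hF, F, rfl⟩ hle)
      · obtain ⟨F, hF⟩ := hm.1.2
        rw [← hc]
        refine Set.ncard_lt_ncard ⟨fun G hG => hG.1, fun hsub => ?_⟩ (Set.toFinite _)
        exact (hsub (show F ∈ {F | lcmLabel lab F ∈ U} by simpa [hF] using hm.1.1)).2 hF.le
      · intro a b hab ha
        exact ⟨hU hab ha.1, fun hb => ha.2 (hab.trans hb)⟩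
    · exact base U (by simpa using hne)

/-! ### Simplicial chains over a field -/

open Classical in
/-- The augmented simplicial boundary on the chains of the full simplex on `V`, a chain being
identified with its coefficient function. The empty face is included, and each face containing `G`
as a facet contributes to the coefficient at `G`. -/
noncomputable def chainBoundary {k V : Type*} [Field k] [Fintype V] (ord : LinearOrder V)
    (c : Finset V → k) (G : Finset V) : k :=
  ∑ v, if v ∈ G then 0 else (-1 : k) ^ vertexPosition ord G v * c (insert v G)

section Chains

variable {k V : Type*} [Field k] [Fintype V] (ord : LinearOrder V)

open Classical in
lemma vertexPosition_insert {V : Type*} (ord : LinearOrder V) (G : Finset V) {v w : V}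
    (hv : v ∉ G) :
    vertexPosition ord (insert v G) w =
      vertexPosition ord G w + if ord.lt v w then 1 else 0 := by
  unfold vertexPosition
  rw [Finset.filter_insert]
  split_ifs with h
  · rw [Finset.card_insert_of_notMem (by simp [hv])]
  · rfl

open Classical in
lemma vertexPosition_insert_self {V : Type*} (ord : LinearOrder V) (G : Finset V) {v : V}
    (hv : v ∉ G) :
    vertexPosition ord (insert v G) v = vertexPosition ord G v := by
  rw [vertexPosition_insert ord G hv, if_neg (@lt_irrefl V ord.toPreorder v), add_zero]

lemma chainBoundary_sub (c c' : Finset V → k) :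
    chainBoundary ord (c - c') = chainBoundary ord c - chainBoundary ord c' := by
  classical
  ext G
  simp only [chainBoundary, Pi.sub_apply, ← Finset.sum_sub_distrib]
  refine Finset.sum_congr rfl fun v _ => ?_
  split_ifs <;> ring

lemma chainBoundary_zero : chainBoundary ord (0 : Finset V → k) = 0 := by
  have := chainBoundary_sub ord (0 : Finset V → k) 0
  simpa using this

lemma chainBoundary_add (c c' : Finset V → k) :
    chainBoundary ord (c + c') = chainBoundary ord c + chainBoundary ord c' := by
  classical
  ext G
  simp only [chainBoundary, Pi.add_apply, ← Finset.sum_add_distrib]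
  refine Finset.sum_congr rfl fun v _ => ?_
  split_ifs <;> ring

lemma chainBoundary_chainBoundary (c : Finset V → k) :
    chainBoundary ord (chainBoundary ord c) = 0 := by
  classical
  ext G
  simp only [chainBoundary, Pi.zero_apply]
  have key : ∀ v w : V, v ∉ G → w ∉ G → ord.lt v w →
      (-1 : k) ^ vertexPosition ord G v * ((-1) ^ vertexPosition ord (insert v G) w) =
      - ((-1 : k) ^ vertexPosition ord G w * ((-1) ^ vertexPosition ord (insert w G) v)) := by
    intro v w hv hw h
    rw [vertexPosition_insert ord G hv, vertexPosition_insert ord G hw, if_pos h,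
      if_neg (@lt_asymm V ord.toPreorder _ _ h)]
    ring
  have key' : ∀ v w : V, v ∉ G → w ∉ G → v ≠ w →
      (-1 : k) ^ vertexPosition ord G v * ((-1) ^ vertexPosition ord (insert v G) w) =
      - ((-1 : k) ^ vertexPosition ord G w * ((-1) ^ vertexPosition ord (insert w G) v)) := by
    intro v w hv hw h
    rcases @lt_or_gt_of_ne V ord v w h with h | h
    · exact key v w hv hw h
    · rw [key w v hw hv h, neg_neg]
  have : ∀ v : V, (if v ∈ G then 0 else (-1 : k) ^ vertexPosition ord G v *
      ∑ w, if w ∈ insert v G then 0 else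
        (-1) ^ vertexPosition ord (insert v G) w * c (insert w (insert v G))) =
      ∑ w, if v ∈ G ∨ w ∈ insert v G then 0 else (-1 : k) ^ vertexPosition ord G v *
        ((-1) ^ vertexPosition ord (insert v G) w) * c (insert w (insert v G)) := by
    intro v
    by_cases hv : v ∈ G
    · simp [hv]
    · simp only [hv, if_false, false_or, Finset.mul_sum]
      refine Finset.sum_congr rfl fun w _ => ?_
      split_ifs <;> ring
  simp_rw [this]
  rw [← Finset.sum_product']
  -- The terms for `(v, w)` and `(w, v)` cancel.
  refine Finset.sum_involution (fun p _ => (p.2, p.1)) ?_ ?_ (fun _ _ => by simp)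
    (fun _ _ => rfl)
  · rintro ⟨v, w⟩ -
    dsimp only
    by_cases hvw : v = w
    · subst hvw; simp
    by_cases hv : v ∈ G
    · simp [hv]
    by_cases hw : w ∈ G
    · simp [hw]
    have hwv : w ≠ v := fun h => hvw h.symm
    simp only [Finset.mem_insert, hv, hw, hvw, hwv, or_self, if_false]
    rw [key' v w hv hw hvw, Finset.insert_comm w v]
    ring
  · rintro ⟨v, w⟩ - h he
    obtain rfl : w = v := congrArg Prod.fst he
    simp at h

/-- The chain `c` is supported on the family `K` of faces. -/
def ChainSupported (K : Set (Finset V)) (c : Finset V → k) : Prop :=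
  ∀ F, c F ≠ 0 → F ∈ K

lemma ChainSupported.chainBoundary {K : Set (Finset V)} (hK : IsLowerSet K) {c : Finset V → k}
    (hc : ChainSupported K c) : ChainSupported K (chainBoundary ord c) := by
  classical
  intro G hG
  by_contra hGK
  refine hG (Finset.sum_eq_zero fun v _ => ?_)
  split_ifs with hv
  · rfl
  · have : c (insert v G) = 0 := by
      by_contra h
      exact hGK (hK (Finset.subset_insert v G) (hc _ h))
    rw [this, mul_zero]

open Classical in
/-- Let `T` be a set of faces of `K` that is closed upwards in `K` and stable under inserting and
removing the vertex `u`. A chain of `K` whose boundary vanishes on `T` is homologous in `K` to a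
chain which vanishes on `T`. -/
lemma exists_homologous_vanishing_of_toggle {K T : Set (Finset V)} (hK : IsLowerSet K)
    (hTK : T ⊆ K) (hT : ∀ F ∈ T, ∀ G ∈ K, F ⊆ G → G ∈ T) (u : V)
    (hu : ∀ F, insert u F ∈ T ↔ F ∈ T) {w : Finset V → k} (hw : ChainSupported K w)
    (hwT : ∀ F ∈ T, chainBoundary ord w F = 0) :
    ∃ y : Finset V → k, ChainSupported K y ∧
      ChainSupported (K \ T) (w - chainBoundary ord y) := by
  -- `y` is, up to sign, the cone with apex `u` over the part of `w` that is supported on `T`.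
  let y : Finset V → k := fun F =>
    if u ∈ F ∧ F ∈ T then (-1) ^ vertexPosition ord (F.erase u) u * w (F.erase u) else 0
  have hy : ChainSupported K y := by
    intro F hF
    by_cases h : u ∈ F ∧ F ∈ T
    · exact hTK h.2
    · exact absurd (if_neg h) hF
  have hsupp : ChainSupported K (w - chainBoundary ord y) := by
    intro F hF
    by_contra hFK
    have h1 : w F = 0 := by
      by_contra h; exact hFK (hw F h)
    have h2 : chainBoundary ord y F = 0 := by
      by_contra h; exact hFK (hy.chainBoundary ord hK F h)
    exact hF (by simp [h1, h2])
  -- At `F ∌ u` the boundary of the cone contributes just `w F`, from the face `F ∪ {u}`.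
  have h1 : ∀ F ∈ T, u ∉ F → (w - chainBoundary ord y) F = 0 := by
    intro F hF huF
    have : chainBoundary ord y F = w F := by
      rw [chainBoundary, Finset.sum_eq_single u]
      · rw [if_neg huF]
        have : y (insert u F) = (-1) ^ vertexPosition ord F u * w F := by
          simp only [y]
          rw [if_pos ⟨Finset.mem_insert_self u F, (hu F).2 hF⟩, Finset.erase_insert huF]
        rw [this, ← mul_assoc, ← mul_pow]
        simp
      · intro v _ hvu
        split_ifs with hv
        · rfl
        · have : y (insert v F) = 0 := by
            refine if_neg fun h => ?_
            rcases Finset.mem_insert.1 h.1 with h | h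
            · exact hvu h.symm
            · exact huF h
          rw [this, mul_zero]
      · simp
    simp [this]
  -- At `F ∋ u` the value is determined by the vanishing of the boundary at `F \ {u}`, because by
  -- `h1` and the support condition no other face contributes there.
  have h2 : ∀ F ∈ T, u ∈ F → (w - chainBoundary ord y) F = 0 := by
    intro F hF huF
    have hE : F.erase u ∈ T := by
      rw [← hu, Finset.insert_erase huF]; exact hF
    have h0 : chainBoundary ord (w - chainBoundary ord y) (F.erase u) = 0 := by
      rw [chainBoundary_sub, chainBoundary_chainBoundary, sub_zero]
      exact hwT _ hE
    rw [chainBoundary, Finset.sum_eq_single u, if_neg (Finset.notMem_erase u F),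
      Finset.insert_erase huF] at h0
    · exact (mul_eq_zero.1 h0).resolve_left (pow_ne_zero _ (by simp))
    · intro v _ hvu
      split_ifs with hv
      · rfl
      · have : (w - chainBoundary ord y) (insert v (F.erase u)) = 0 := by
          by_contra h
          refine h (h1 _ (hT _ hE _ (hsupp _ h) (Finset.subset_insert _ _)) ?_)
          simp [Ne.symm hvu]
        rw [this, mul_zero]
    · simp
  refine ⟨y, hy, fun F hF => ⟨hsupp F hF, fun hFT => hF ?_⟩⟩
  by_cases huF : u ∈ F
  · exact h2 F hFT huF
  · exact h1 F hFT huF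

/-- The faces of multidegree at most `b` whose least common multiple is not properly divisible by
a label form an acyclic complex, as soon as one label divides `b`. -/
lemma exists_chainBoundary_eq {n : ℕ} (lab : V → (Fin n →₀ ℕ)) {b : Fin n →₀ ℕ}
    {g : V} (hg : lab g ≤ b) {c : Finset V → k}
    (hc : ChainSupported {F | lcmLabel lab F ≤ b ∧ lcmLabel lab F ∉ properMultiples lab} c)
    (h0 : chainBoundary ord c = 0) :
    ∃ w : Finset V → k,
      ChainSupported {F | lcmLabel lab F ≤ b ∧ lcmLabel lab F ∉ properMultiples lab} w ∧
        chainBoundary ord w = c := by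
  classical
  refine upperSet_label_induction lab
    (P := fun U => ∀ c : Finset V → k, ChainSupported {F | lcmLabel lab F ≤ b ∧
      lcmLabel lab F ∉ U} c → chainBoundary ord c = 0 → ∃ w : Finset V → k,
      ChainSupported {F | lcmLabel lab F ≤ b ∧ lcmLabel lab F ∉ U} w ∧ chainBoundary ord w = c)
    (properMultiples lab) (isUpperSet_properMultiples lab) ?_ ?_ c hc h0
  -- If nothing is deleted, the complex is a cone with apex `g`, and `T` may be the whole complex.
  · intro U hU c hc h0
    have hlow : IsLowerSet {F | lcmLabel lab F ≤ b ∧ lcmLabel lab F ∉ U} :=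
      fun F G hGF hF => ⟨(lcmLabel_mono lab hGF).trans hF.1, hU G⟩
    have htoggle : ∀ F, insert g F ∈ {F | lcmLabel lab F ≤ b ∧ lcmLabel lab F ∉ U} ↔
        F ∈ {F | lcmLabel lab F ≤ b ∧ lcmLabel lab F ∉ U} := by
      intro F
      have : lcmLabel lab (insert g F) = lab g ⊔ lcmLabel lab F := Finset.sup_insert
      simp [hU, this, hg]
    obtain ⟨y, hy, hy'⟩ := exists_homologous_vanishing_of_toggle ord hlow subset_rfl
      (fun _ _ _ h _ => h) g htoggle hc (fun F _ => by rw [h0]; rfl)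
    refine ⟨y, hy, ?_⟩
    ext F
    by_contra hF
    exact absurd (hy' F fun h => hF (sub_eq_zero.1 h).symm) (by simp)
  -- A primitive in the larger complex is changed by a boundary so that it avoids the
  -- multidegree `m`.
  · intro U hUN hU m hm hmin ih c hc h0
    obtain ⟨w, hw, hwc⟩ := ih c (fun F hF => ⟨(hc F hF).1, fun h => (hc F hF).2 h.1⟩) h0
    obtain ⟨u, hu⟩ := hUN hm
    have hlow : IsLowerSet {F | lcmLabel lab F ≤ b ∧ lcmLabel lab F ∉ U \ Set.Iic m} := by
      intro F G hGF hF
      have hle := lcmLabel_mono lab hGF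
      exact ⟨hle.trans hF.1, fun h => hF.2 ⟨hU hle h.1, fun h' => h.2 (hle.trans h')⟩⟩
    set K := {F | lcmLabel lab F ≤ b ∧ lcmLabel lab F ∉ U \ Set.Iic m}
    set T := {F | lcmLabel lab F ≤ b ∧ lcmLabel lab F = m}
    have hTK : T ⊆ K := fun F hF => ⟨hF.1, fun h => h.2 hF.2.le⟩
    have hT : ∀ F ∈ T, ∀ G ∈ K, F ⊆ G → G ∈ T := by
      rintro F ⟨-, hF⟩ G hG hFG
      have hGU : lcmLabel lab G ∈ U := hU (lcmLabel_mono lab hFG) (hF ▸ hm)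
      refine ⟨hG.1, hmin G hGU ?_⟩
      by_contra h'
      exact hG.2 ⟨hGU, h'⟩
    have htoggle : ∀ F, insert u F ∈ T ↔ F ∈ T := by
      intro F
      have hiff := lcmLabel_insert_eq_iff hu F
      refine ⟨fun h => ⟨?_, hiff.1 h.2⟩, fun h => ⟨?_, hiff.2 h.2⟩⟩
      · rw [hiff.1 h.2, ← h.2]; exact h.1
      · rw [hiff.2 h.2, ← h.2]; exact h.1
    have hwT : ∀ F ∈ T, chainBoundary ord w F = 0 := by
      rintro F ⟨-, hF⟩
      rw [hwc]
      by_contra h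
      exact (hc F h).2 (hF ▸ hm)
    obtain ⟨y, hy, hy'⟩ :=
      exists_homologous_vanishing_of_toggle ord hlow hTK hT u htoggle hw hwT
    refine ⟨w - chainBoundary ord y, fun F hF => ?_, ?_⟩
    · obtain ⟨⟨h1, h2⟩, h3⟩ := hy' F hF
      refine ⟨h1, fun h => h3 ⟨h1, hmin F h ?_⟩⟩
      by_contra h'
      exact h2 ⟨h, h'⟩
    · rw [chainBoundary_sub, chainBoundary_chainBoundary, hwc, sub_zero]

end Chains

/-! ### Contractibility -/

/-- The points of the standard simplex on `V` whose support lies in a member of `K`. -/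
def realizationOf {V : Type*} [Fintype V] (K : Set (Finset V)) : Set (V → ℝ) :=
  {x | (∀ v, 0 ≤ x v) ∧ ∑ v, x v = 1 ∧ ∃ F ∈ K, ∀ v, v ∉ F → x v = 0}

lemma contractibleSpace_of_retract {X Y : Type*} [TopologicalSpace X] [TopologicalSpace Y]
    [ContractibleSpace Y] (i : C(X, Y)) (r : C(Y, X)) (h : r.comp i = ContinuousMap.id X) :
    ContractibleSpace X := by
  rw [contractible_iff_id_nullhomotopic, ← h]
  have := ((id_nullhomotopic Y).comp_right r).comp_left i
  simpa using this

/-- Pushing down by `t`, but not below `0`, the barycentric coordinates of the vertices other than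
`u`; the coordinate at `u` is chosen to keep the total mass `1`. -/
noncomputable def pushToward {V : Type*} [Fintype V] [DecidableEq V] (u : V) (t : ℝ) (x : V → ℝ) :
    V → ℝ :=
  fun v => if v = u then 1 - ∑ w ∈ Finset.univ.erase u, max (x w - t) 0 else max (x v - t) 0

section Retraction

variable {V : Type*} [Fintype V] {n : ℕ}

lemma sum_pushToward [DecidableEq V] (u : V) (t : ℝ) (x : V → ℝ) :
    ∑ v, pushToward u t x v = 1 := by
  rw [← Finset.add_sum_erase _ _ (Finset.mem_univ u)]
  have : ∑ v ∈ Finset.univ.erase u, pushToward u t x v =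
      ∑ w ∈ Finset.univ.erase u, max (x w - t) 0 :=
    Finset.sum_congr rfl fun v hv => if_neg (Finset.ne_of_mem_erase hv)
  rw [this, pushToward, if_pos rfl]
  ring

lemma pushToward_nonneg [DecidableEq V] (u : V) {t : ℝ} (ht : 0 ≤ t) {x : V → ℝ}
    (hx : ∀ v, 0 ≤ x v) (h1 : ∑ v, x v = 1) (v : V) : 0 ≤ pushToward u t x v := by
  unfold pushToward
  split_ifs
  · have : ∑ w ∈ Finset.univ.erase u, max (x w - t) 0 ≤ ∑ w ∈ Finset.univ.erase u, x w :=
      Finset.sum_le_sum fun w _ => max_le (by linarith) (hx w)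
    have h2 := Finset.add_sum_erase _ x (Finset.mem_univ u)
    have := hx u
    linarith
  · exact le_max_right _ _

lemma pushToward_zero [DecidableEq V] (u : V) {x : V → ℝ} (hx : ∀ v, 0 ≤ x v)
    (h1 : ∑ v, x v = 1) :
    pushToward u 0 x = x := by
  ext v
  have h3 : ∀ w, max (x w - 0) 0 = x w := fun w => by rw [sub_zero, max_eq_left (hx w)]
  simp only [pushToward, h3]
  split_ifs with h
  · subst h
    have h2 := Finset.add_sum_erase _ x (Finset.mem_univ v)
    linarith
  · rfl

/-- The largest barycentric coordinate of `x` at a vertex whose label is at least `m` in the `i`-th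
coordinate; `0` if there is no such vertex. At a nonnegative `x` it vanishes exactly if the
support of `x` contains no such vertex. -/
noncomputable def attainingMass [Nonempty V] (lab : V → (Fin n →₀ ℕ)) (m : Fin n →₀ ℕ) (i : Fin n)
    (x : V → ℝ) : ℝ :=
  Finset.univ.sup' Finset.univ_nonempty fun v => if m i ≤ lab v i then x v else 0

lemma attainingMass_nonneg [Nonempty V] (lab : V → (Fin n →₀ ℕ)) (m : Fin n →₀ ℕ) (i : Fin n)
    {x : V → ℝ} (hx : ∀ v, 0 ≤ x v) : 0 ≤ attainingMass lab m i x := by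
  obtain ⟨v⟩ := ‹Nonempty V›
  refine le_trans ?_ (Finset.le_sup' _ (Finset.mem_univ v))
  split_ifs
  exacts [hx v, le_rfl]

/-- How far the coordinates of `x` have to be pushed down until the labels of the vertices with a
positive coordinate no longer reach some positive coordinate of `m`. It is continuous in `x`, and it
is `0` at nonnegative `x` whose support has a least common multiple not divisible by `m`. -/
noncomputable def stoppingTime [Nonempty V] (lab : V → (Fin n →₀ ℕ)) (m : Fin n →₀ ℕ)
    (hm : m.support.Nonempty) (x : V → ℝ) : ℝ :=
  m.support.inf' hm fun i => attainingMass lab m i x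

lemma continuous_stoppingTime [Nonempty V] (lab : V → (Fin n →₀ ℕ)) (m : Fin n →₀ ℕ)
    (hm : m.support.Nonempty) : Continuous (stoppingTime lab m hm) := by
  refine Continuous.finset_inf'_apply hm fun i _ => ?_
  refine Continuous.finset_sup'_apply _ fun v _ => ?_
  split_ifs
  · exact continuous_apply v
  · exact continuous_const

lemma stoppingTime_nonneg [Nonempty V] (lab : V → (Fin n →₀ ℕ)) (m : Fin n →₀ ℕ)
    (hm : m.support.Nonempty) {x : V → ℝ} (hx : ∀ v, 0 ≤ x v) : 0 ≤ stoppingTime lab m hm x :=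
  Finset.le_inf' hm _ fun i _ => attainingMass_nonneg lab m i hx

lemma stoppingTime_eq_zero [Nonempty V] (lab : V → (Fin n →₀ ℕ)) (m : Fin n →₀ ℕ)
    (hm : m.support.Nonempty) {x : V → ℝ} (hx : ∀ v, 0 ≤ x v) {F : Finset V}
    (hF : ∀ v, v ∉ F → x v = 0) (hmF : ¬ m ≤ lcmLabel lab F) : stoppingTime lab m hm x = 0 := by
  refine le_antisymm ?_ (stoppingTime_nonneg lab m hm hx)
  obtain ⟨i, hi⟩ : ∃ i, lcmLabel lab F i < m i := by
    by_contra! h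
    exact hmF h
  refine (Finset.inf'_le _ (Finsupp.mem_support_iff.2 (by omega : m i ≠ 0))).trans ?_
  refine Finset.sup'_le _ _ fun v _ => ?_
  split_ifs with hv
  · refine (hF v fun hvF => ?_).le
    have := le_lcmLabel lab hvF i
    omega
  · exact le_rfl

/-- After the push the support of `x` lies in a set whose least common multiple divides and differs
from `m`. -/
lemma exists_lt_pushToward_eq_zero [Nonempty V] [DecidableEq V] (lab : V → (Fin n →₀ ℕ))
    (m : Fin n →₀ ℕ) (hm : m.support.Nonempty) {u : V} (hu : ProperlyDivides (lab u) m) {x : V → ℝ}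
    (hx : ∀ v, 0 ≤ x v) {F : Finset V} (hF : ∀ v, v ∉ F → x v = 0) (hmF : lcmLabel lab F = m) :
    ∃ G : Finset V, lcmLabel lab G < m ∧
      ∀ v, v ∉ G → pushToward u (stoppingTime lab m hm x) x v = 0 := by
  obtain ⟨i, hi, hti⟩ := Finset.exists_mem_eq_inf' hm fun i => attainingMass lab m i x
  have hi0 : m i ≠ 0 := Finsupp.mem_support_iff.1 hi
  -- The coordinate `i` at which the infimum is attained is the one that gets lost.
  refine ⟨(insert u F).filter fun v => lab v i < m i, ?_, fun v hv => ?_⟩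
  · have hle : lcmLabel lab ((insert u F).filter fun v => lab v i < m i) ≤ m := by
      refine (lcmLabel_mono lab (Finset.filter_subset _ _)).trans ?_
      have := (lcmLabel_insert_eq_iff hu F).2 hmF
      convert this.le
    refine lt_of_le_of_ne hle fun he => ?_
    have h1 : lcmLabel lab ((insert u F).filter fun v => lab v i < m i) i < m i := by
      rw [lcmLabel_apply, Finset.sup_lt_iff (Nat.pos_of_ne_zero hi0)]
      exact fun v hv => (Finset.mem_filter.1 hv).2
    rw [he] at h1
    exact lt_irrefl _ h1
  · have hvu : v ≠ u := by
      rintro rfl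
      exact hv (by simpa using hu.2.2 i hi0)
    rw [pushToward, if_neg hvu]
    refine max_eq_right ?_
    by_cases hvF : v ∈ F
    · have hvi : m i ≤ lab v i := by
        by_contra h
        exact hv (Finset.mem_filter.2 ⟨Finset.mem_insert_of_mem hvF, not_le.1 h⟩)
      have h2 : x v ≤ attainingMass lab m i x := by
        refine le_trans ?_ (Finset.le_sup' _ (Finset.mem_univ v))
        rw [if_pos hvi]
      have h3 : stoppingTime lab m hm x = attainingMass lab m i x := hti
      linarith
    · rw [hF v hvF]
      have := stoppingTime_nonneg lab m hm hx
      linarith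

end Retraction

/-- Deleting the faces whose least common multiple is properly divisible by a label leaves a
contractible complex: the full simplex is contractible, and the deletion proceeds by retractions
that remove all faces with one and the same least common multiple. -/
theorem contractibleSpace_realizationOf {V : Type*} [Fintype V] [Nonempty V] {n : ℕ}
    (lab : V → (Fin n →₀ ℕ)) :
    ContractibleSpace (realizationOf {F : Finset V | lcmLabel lab F ∉ properMultiples lab}) := by
  classical
  refine upperSet_label_induction lab
    (P := fun U => ContractibleSpace (realizationOf {F : Finset V | lcmLabel lab F ∉ U}))
    (properMultiples lab) (isUpperSet_properMultiples lab) ?_ ?_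
  · intro U hU
    have : realizationOf {F : Finset V | lcmLabel lab F ∉ U} = stdSimplex ℝ V := by
      ext x
      refine ⟨fun h => ⟨h.1, h.2.1⟩, fun h => ⟨h.1, h.2, Finset.univ, hU _, by simp⟩⟩
    rw [this]
    obtain ⟨v⟩ := ‹Nonempty V›
    exact (convex_stdSimplex ℝ V).contractibleSpace ⟨_, single_mem_stdSimplex ℝ v⟩
  · intro U hUN hU m hm hmin ih
    obtain ⟨u, hu⟩ := hUN hm
    have hm0 : m.support.Nonempty := by simpa using hu.ne_zero
    -- Since `U` is an upper set containing `m`, a least common multiple outside `U` is not a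
    -- multiple of `m`, so the points of the smaller complex are not moved.
    have hzero : ∀ x ∈ realizationOf {F : Finset V | lcmLabel lab F ∉ U},
        stoppingTime lab m hm0 x = 0 := by
      rintro x ⟨hx, -, F, hF, hFx⟩
      exact stoppingTime_eq_zero lab m hm0 hx hFx fun h => hF (hU h hm)
    have hmaps : ∀ x ∈ realizationOf {F : Finset V | lcmLabel lab F ∉ U \ Set.Iic m},
        pushToward u (stoppingTime lab m hm0 x) x ∈
          realizationOf {F : Finset V | lcmLabel lab F ∉ U} := by
      rintro x ⟨hx, hx1, F, hF, hFx⟩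
      by_cases hFU : lcmLabel lab F ∈ U
      · have hFm : lcmLabel lab F = m := hmin F hFU (by
          by_contra h
          exact hF ⟨hFU, h⟩)
        obtain ⟨G, hG, hGx⟩ := exists_lt_pushToward_eq_zero lab m hm0 hu hx hFx hFm
        exact ⟨pushToward_nonneg u (stoppingTime_nonneg lab m hm0 hx) hx hx1,
          sum_pushToward u _ x, G, fun h => hG.ne (hmin G h hG.le), hGx⟩
      · have hxU : x ∈ realizationOf {F : Finset V | lcmLabel lab F ∉ U} := ⟨hx, hx1, F, hFU, hFx⟩
        rw [hzero x hxU, pushToward_zero u hx hx1]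
        exact hxU
    have hcont : Continuous fun x : V → ℝ => pushToward u (stoppingTime lab m hm0 x) x := by
      have ht := continuous_stoppingTime lab m hm0
      refine continuous_pi fun v => ?_
      unfold pushToward
      split_ifs <;> fun_prop
    have hsub : realizationOf {F : Finset V | lcmLabel lab F ∉ U} ⊆
        realizationOf {F : Finset V | lcmLabel lab F ∉ U \ Set.Iic m} :=
      fun x ⟨hx, hx1, F, hF, hFx⟩ => ⟨hx, hx1, F, fun h => hF h.1, hFx⟩
    refine contractibleSpace_of_retract ⟨Set.inclusion hsub, continuous_inclusion hsub⟩
      ⟨fun x => ⟨_, hmaps x.1 x.2⟩,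
        (hcont.comp continuous_subtype_val).subtype_mk _⟩ ?_
    ext x : 2
    change pushToward u (stoppingTime lab m hm0 x.1) x.1 = x.1
    rw [hzero x.1 x.2, pushToward_zero u x.2.1 x.2.2.1]

/-! ### The strands of the homogenized chain complex -/

section Strands

variable {k : Type*} [Field k] {n : ℕ} {V : Type*} {K : AbstractSimplicialComplex V}

open Classical in
/-- The strand of multidegree `b` of an `i`-chain `x`: the simplicial chain over `k` whose
coefficient at `F` is the coefficient in `x F` of the monomial `x^(b - lcm F)`. -/
noncomputable def strand (lab : V → (Fin n →₀ ℕ)) (i : ℕ) (b : Fin n →₀ ℕ) :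
    CellularModule k n K i →+ (Finset V → k) where
  toFun x F := if h : F ∈ K ∧ F.card = i + 1 then
    if lcmLabel lab F ≤ b then coeff (b - lcmLabel lab F) (x ⟨F, h⟩) else 0 else 0
  map_zero' := by
    ext F
    simp
  map_add' x y := by
    ext F
    by_cases h : F ∈ K ∧ F.card = i + 1
    · by_cases h' : lcmLabel lab F ≤ b <;> simp [h, h']
    · simp [h]

variable (lab : V → (Fin n →₀ ℕ)) {i : ℕ}

lemma strand_support {b : Fin n →₀ ℕ} {x : CellularModule k n K i} {F : Finset V}
    (h : strand lab i b x F ≠ 0) : F ∈ K ∧ F.card = i + 1 ∧ lcmLabel lab F ≤ b := by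
  classical
  by_cases h1 : F ∈ K ∧ F.card = i + 1
  · by_cases h2 : lcmLabel lab F ≤ b
    · exact ⟨h1.1, h1.2, h2⟩
    · exact absurd (by simp [strand, h2]) h
  · exact absurd (by simp [strand, h1]) h

lemma strand_apply_face {b : Fin n →₀ ℕ} (x : CellularModule k n K i) (F : FaceOfDim K i)
    (hF : lcmLabel lab F.1 ≤ b) : strand lab i b x F.1 = coeff (b - lcmLabel lab F.1) (x F) := by
  exact (dif_pos F.2).trans (if_pos hF)

lemma strand_apply_add (a : Fin n →₀ ℕ) (x : CellularModule k n K i) (F : FaceOfDim K i) :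
    strand lab i (a + lcmLabel lab F.1) x F.1 = coeff a (x F) := by
  rw [strand_apply_face lab x F le_add_self, add_tsub_cancel_right]

lemma strand_ext {x y : CellularModule k n K i} (h : ∀ b, strand lab i b x = strand lab i b y) :
    x = y := by
  ext F a
  rw [← strand_apply_add lab, ← strand_apply_add lab, h]

open Classical in
lemma strand_single (b : Fin n →₀ ℕ) (F : FaceOfDim K i) (p : MvPolynomial (Fin n) k)
    (G : Finset V) : strand lab i b (Finsupp.single F p) G =
      if G = F.1 ∧ lcmLabel lab F.1 ≤ b then coeff (b - lcmLabel lab F.1) p else 0 := by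
  by_cases hG : G = F.1
  · subst hG
    by_cases h : lcmLabel lab F.1 ≤ b
    · rw [strand_apply_face lab _ F h, Finsupp.single_eq_same, if_pos ⟨rfl, h⟩]
    · rw [if_neg fun h' => h h'.2]
      by_contra h'
      exact h (strand_support lab h').2.2
  · rw [if_neg fun h' => hG h'.1]
    by_contra h
    have hs := strand_support lab h
    have := strand_apply_face lab (Finsupp.single F p) ⟨G, hs.1, hs.2.1⟩ hs.2.2
    rw [Finsupp.single_eq_of_ne (fun he => hG (congrArg Subtype.val he))] at this
    exact h (by simpa using this)

lemma finite_strand_ne_zero (x : CellularModule k n K i) :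
    {b | strand lab i b x ≠ 0}.Finite := by
  classical
  refine (Set.Finite.biUnion x.support.finite_toSet fun F _ =>
    ((x F).support.finite_toSet.image fun a => a + lcmLabel lab F.1)).subset ?_
  intro b hb
  obtain ⟨F, hF⟩ := Function.ne_iff.1 hb
  have hs := strand_support lab hF
  have h := strand_apply_face lab x ⟨F, hs.1, hs.2.1⟩ hs.2.2
  rw [h] at hF
  simp only [Set.mem_iUnion, Set.mem_image, Finset.mem_coe]
  refine ⟨⟨F, hs.1, hs.2.1⟩, ?_, b - lcmLabel lab F, ?_, tsub_add_cancel_of_le hs.2.2⟩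
  · rw [Finsupp.mem_support_iff]
    intro h0
    rw [h0] at hF
    exact hF rfl
  · exact mem_support_iff.2 hF

/-- A chain may be prescribed by its strands. -/
lemma exists_strand_eq [Finite V] (c : (Fin n →₀ ℕ) → Finset V → k)
    (hfin : {b | c b ≠ 0}.Finite)
    (hc : ∀ b F, c b F ≠ 0 → F ∈ K ∧ F.card = i + 1 ∧ lcmLabel lab F ≤ b) :
    ∃ x : CellularModule k n K i, ∀ b, strand lab i b x = c b := by
  classical
  have : Fintype V := Fintype.ofFinite V
  refine ⟨Finsupp.equivFunOnFinite.symm fun F => ∑ b ∈ hfin.toFinset,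
    if lcmLabel lab F.1 ≤ b then monomial (b - lcmLabel lab F.1) (c b F.1) else 0, fun b => ?_⟩
  ext F
  by_cases hF : F ∈ K ∧ F.card = i + 1 ∧ lcmLabel lab F ≤ b
  · rw [strand_apply_face lab _ ⟨F, hF.1, hF.2.1⟩ hF.2.2, Finsupp.coe_equivFunOnFinite_symm,
      coeff_sum, Finset.sum_eq_single b]
    · rw [if_pos hF.2.2, coeff_monomial, if_pos rfl]
    · intro b' _ hb'
      split_ifs with h
      · rw [coeff_monomial, if_neg]
        intro he
        exact hb' (by rw [← tsub_add_cancel_of_le h, he, tsub_add_cancel_of_le hF.2.2])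
      · simp
    · intro hb
      have : c b = 0 := by simpa using hb
      simp [this]
  · have h1 : ∀ x : CellularModule k n K i, strand lab i b x F = 0 := by
      intro x; by_contra h; exact hF (strand_support lab h)
    have h2 : c b F = 0 := by
      by_contra h; exact hF (hc b F h)
    rw [h1, h2]

variable [Fintype V] (ord : LinearOrder V)

/-- On strands the homogenized differential is the simplicial boundary. -/
lemma strand_cellularDifferential (b : Fin n →₀ ℕ) (x : CellularModule k n K (i + 1)) :
    strand lab i b (cellularDifferential k K lab ord i x) =
      chainBoundary ord (strand lab (i + 1) b x) := by
  classical
  induction x using Finsupp.induction_linear with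
  | zero => simp [chainBoundary_zero]
  | add x y hx hy => simp only [map_add, hx, hy, chainBoundary_add]
  | single F p =>
    rw [cellularDifferential, Finsupp.linearCombination_single, Finset.smul_sum, map_sum]
    ext G
    rw [Finset.sum_apply, chainBoundary]
    have hterm : ∀ v : {v // v ∈ F.1}, strand lab i b (p • Finsupp.single (F.erase v.1 v.2)
        (monomial (lcmLabel lab F.1 - lcmLabel lab (F.erase v.1 v.2).1)
          ((-1 : k) ^ vertexPosition ord F.1 v.1))) G =
        if G = (F.1.erase v.1) ∧ lcmLabel lab F.1 ≤ b then
          coeff (b - lcmLabel lab F.1) p * (-1 : k) ^ vertexPosition ord F.1 v.1 else 0 := by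
      intro v
      have hE : (F.erase v.1 v.2).1 = F.1.erase v.1 := by
        ext w; simp [FaceOfDim.erase]
      rw [Finsupp.smul_single, strand_single, hE, smul_eq_mul, coeff_mul_monomial']
      have hle : lcmLabel lab (F.1.erase v.1) ≤ lcmLabel lab F.1 :=
        lcmLabel_mono lab (Finset.erase_subset _ _)
      by_cases hG : G = F.1.erase v.1
      · by_cases hF : lcmLabel lab F.1 ≤ b
        · rw [if_pos ⟨hG, hle.trans hF⟩, if_pos (tsub_le_tsub_right hF _),
            tsub_tsub_tsub_cancel_right hle, if_pos ⟨hG, hF⟩]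
        · rw [if_neg (fun h => hF h.2 : ¬(G = F.1.erase v.1 ∧ lcmLabel lab F.1 ≤ b))]
          split_ifs with h1 h2
          · exact absurd ((tsub_le_tsub_iff_right h1.2).1 h2) hF
          · rfl
          · rfl
      · rw [if_neg fun h => hG h.1, if_neg fun h => hG h.1]
    rw [Finset.sum_congr rfl fun v _ => hterm v,
      Finset.sum_attach F.1 fun v => if G = F.1.erase v ∧ lcmLabel lab F.1 ≤ b then
          coeff (b - lcmLabel lab F.1) p * (-1 : k) ^ vertexPosition ord F.1 v else 0,
      ← Finset.sum_filter_add_sum_filter_not Finset.univ (· ∈ F.1)]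
    have hz : ∑ v ∈ Finset.univ.filter (· ∉ F.1), (if v ∈ G then 0 else
        (-1 : k) ^ vertexPosition ord G v *
          strand lab (i + 1) b (Finsupp.single F p) (insert v G)) = 0 := by
      refine Finset.sum_eq_zero fun v hv => ?_
      have : insert v G ≠ F.1 := by
        rintro h
        exact (Finset.mem_filter.1 hv).2 (h ▸ Finset.mem_insert_self v G)
      have h0 : strand lab (i + 1) b (Finsupp.single F p) (insert v G) = 0 := by
        rw [strand_single, if_neg fun h => this h.1]
      rw [h0, mul_zero, ite_self]
    rw [hz, add_zero, Finset.filter_univ_mem]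
    refine Finset.sum_congr rfl fun v hv => ?_
    rw [strand_single]
    by_cases hG : G = F.1.erase v
    · have hvG : v ∉ G := hG ▸ Finset.notMem_erase v F.1
      have hins : insert v G = F.1 := by rw [hG, Finset.insert_erase hv]
      rw [if_neg hvG, ← vertexPosition_insert_self ord G hvG, hins]
      simp only [hG, true_and]
      split_ifs <;> ring
    · rw [if_neg fun h => hG h.1]
      by_cases hvG : v ∈ G
      · rw [if_pos hvG]
      · have : insert v G ≠ F.1 := by
          rintro h
          exact hG (by rw [← h, Finset.erase_insert hvG])
        rw [if_neg hvG, if_neg fun h => this h.1, mul_zero]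

lemma coeff_cellularAugmentation (b : Fin n →₀ ℕ) (x : CellularModule k n K 0) :
    coeff b (cellularAugmentation k K lab x) = chainBoundary ord (strand lab 0 b x) ∅ := by
  classical
  induction x using Finsupp.induction_linear with
  | zero => simp [chainBoundary_zero]
  | add x y hx hy => simp only [map_add, coeff_add, hx, hy, chainBoundary_add, Pi.add_apply]
  | single F p =>
    obtain ⟨v, hv⟩ := Finset.card_eq_one.1 F.2.2
    rw [cellularAugmentation, Finsupp.linearCombination_single, smul_eq_mul, coeff_mul_monomial',
      chainBoundary, Finset.sum_eq_single v]
    · rw [strand_single]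
      have hins : insert v ∅ = F.1 := by rw [hv]; rfl
      simp [hins, vertexPosition]
    · intro w _ hw
      have : insert w ∅ ≠ F.1 := by
        rw [hv]
        intro h
        exact hw (Finset.singleton_injective h)
      have h0 : strand lab 0 b (Finsupp.single F p) (insert w ∅) = 0 := by
        rw [strand_single, if_neg fun h => this h.1]
      rw [h0, mul_zero, ite_self]
    · simp

/-- A chain all of whose strands are cycles is a boundary, provided that the subcomplexes of `K`
of bounded multidegree are acyclic. -/
lemma exists_cellularDifferential_eq
    (hK : ∀ (b : Fin n →₀ ℕ) (v : V), lab v ≤ b → ∀ c : Finset V → k,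
      ChainSupported {F | lcmLabel lab F ≤ b ∧ (F.Nonempty → F ∈ K)} c → chainBoundary ord c = 0 →
      ∃ w : Finset V → k, ChainSupported {F | lcmLabel lab F ≤ b ∧ (F.Nonempty → F ∈ K)} w ∧
        chainBoundary ord w = c)
    (y : CellularModule k n K i) (hy : ∀ b, chainBoundary ord (strand lab i b y) = 0) :
    ∃ x, cellularDifferential k K lab ord i x = y := by
  classical
  have key : ∀ b, ∃ w : Finset V → k, (strand lab i b y = 0 → w = 0) ∧
      (∀ F, w F ≠ 0 → F ∈ K ∧ F.card = i + 1 + 1 ∧ lcmLabel lab F ≤ b) ∧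
      chainBoundary ord w = strand lab i b y := by
    intro b
    by_cases h0 : strand lab i b y = 0
    · exact ⟨0, fun _ => rfl, fun F hF => absurd rfl hF, by rw [h0, chainBoundary_zero]⟩
    obtain ⟨F, hF⟩ := Function.ne_iff.1 h0
    have hs := strand_support lab hF
    obtain ⟨v, hv⟩ : F.Nonempty := Finset.card_pos.1 (by omega)
    obtain ⟨w, hw, hwy⟩ := hK b v ((le_lcmLabel lab hv).trans hs.2.2) (strand lab i b y)
      (fun G hG => ⟨(strand_support lab hG).2.2, fun _ => (strand_support lab hG).1⟩) (hy b)
    -- Only the part of `w` of the right dimension contributes.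
    refine ⟨fun G => if G.card = i + 1 + 1 then w G else 0, fun h => absurd h h0, ?_, ?_⟩
    · intro G hG
      have hcard : G.card = i + 1 + 1 := by
        by_contra h
        exact hG (if_neg h)
      have hwG : w G ≠ 0 := by simpa [hcard] using hG
      exact ⟨(hw G hwG).2 (Finset.card_pos.1 (by omega)), hcard, (hw G hwG).1⟩
    · ext G
      by_cases hG : G.card = i + 1
      · rw [← hwy]
        refine Finset.sum_congr rfl fun v _ => ?_
        split_ifs with h1
        · rfl
        · dsimp only
          rw [if_pos (by rw [Finset.card_insert_of_notMem h1, hG])]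
      · have h1 : strand lab i b y G = 0 := by
          by_contra h
          exact hG (strand_support lab h).2.1
        rw [h1]
        refine Finset.sum_eq_zero fun v _ => ?_
        split_ifs with h1
        · rfl
        · dsimp only
          rw [if_neg (by rw [Finset.card_insert_of_notMem h1]; omega), mul_zero]
  choose w hw0 hw hwy using key
  obtain ⟨x, hx⟩ := exists_strand_eq (K := K) (i := i + 1) lab w
    ((finite_strand_ne_zero lab y).subset fun b hb h => hb (hw0 b h)) hw
  exact ⟨x, strand_ext lab fun b => by rw [strand_cellularDifferential, hx, hwy]⟩

lemma chainBoundary_strand_apply_of_card_ne {b : Fin n →₀ ℕ} (x : CellularModule k n K i)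
    {G : Finset V} (hG : G.card ≠ i) : chainBoundary ord (strand lab i b x) G = 0 := by
  classical
  refine Finset.sum_eq_zero fun v _ => ?_
  split_ifs with h
  · rfl
  · have : strand lab i b x (insert v G) = 0 := by
      by_contra h'
      have := (strand_support lab h').2.1
      rw [Finset.card_insert_of_notMem h] at this
      omega
    rw [this, mul_zero]

end Strands

/-! ### The grading -/

section Grading

variable {k : Type*} [Field k] {n : ℕ} {V : Type*} {K : AbstractSimplicialComplex V}
  (lab : V → (Fin n →₀ ℕ)) {i : ℕ}

/-- A chain is homogeneous of multidegree `a` iff the strand of multidegree `a` is the only one that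
may be nonzero. -/
lemma mem_cellularGrading_iff {a : Fin n →₀ ℕ} {x : CellularModule k n K i} :
    x ∈ cellularGrading k K lab i a ↔ ∀ b, b ≠ a → strand lab i b x = 0 := by
  refine ⟨fun h b hb => ?_, fun h F b hb => ?_⟩
  · ext F
    by_contra hF
    have hs := strand_support lab hF
    have hx := strand_apply_face lab x ⟨F, hs.1, hs.2.1⟩ hs.2.2
    have := h ⟨F, hs.1, hs.2.1⟩ _ (hx ▸ hF)
    exact hb (by rw [← this]; exact (tsub_add_cancel_of_le hs.2.2).symm)
  · by_contra hne
    have := strand_apply_add lab b x F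
    rw [h _ hne] at this
    exact hb this.symm

lemma single_monomial_mem_cellularGrading (F : FaceOfDim K i) (b : Fin n →₀ ℕ) (c : k) :
    Finsupp.single F (monomial b c) ∈ cellularGrading k K lab i (b + lcmLabel lab F.1) := by
  classical
  intro G b' hb'
  by_cases hG : G = F
  · subst hG
    rw [Finsupp.single_eq_same, coeff_monomial] at hb'
    by_cases hbb : b = b'
    · rw [hbb]
    · exact absurd (if_neg hbb) hb'
  · rw [Finsupp.single_eq_of_ne hG] at hb'
    simp at hb'

lemma monomial_smul_mem_cellularGrading (a b : Fin n →₀ ℕ) (c : k) (x : CellularModule k n K i)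
    (hx : x ∈ cellularGrading k K lab i b) :
    monomial a c • x ∈ cellularGrading k K lab i (a + b) := by
  intro F b' hb'
  rw [Finsupp.smul_apply, smul_eq_mul, coeff_monomial_mul'] at hb'
  split_ifs at hb' with h
  · rw [← hx F (b' - a) (right_ne_zero_of_mul hb'), ← add_assoc, add_tsub_cancel_of_le h]
  · exact absurd rfl hb'

lemma isInternal_cellularGrading : DirectSum.IsInternal (cellularGrading k K lab i) := by
  classical
  constructor
  · rw [injective_iff_map_eq_zero]
    intro x hx
    ext a : 2
    refine strand_ext lab fun b => ?_
    have h := congrArg (strand lab i a) hx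
    rw [map_zero] at h
    by_cases hb : b = a
    · subst hb
      rw [DirectSum.coeAddMonoidHom_eq_dfinsuppSum, DFinsupp.sum, map_sum,
        Finset.sum_eq_single b] at h
      · simpa using h
      · exact fun a' _ ha' => (mem_cellularGrading_iff lab).1 (x a').2 b ha'.symm
      · intro hb
        rw [DFinsupp.notMem_support_iff] at hb
        rw [hb]
        simp
    · rw [(mem_cellularGrading_iff lab).1 (x a).2 b hb]
      simp
  · intro x
    induction x using Finsupp.induction_linear with
    | zero => exact ⟨0, map_zero _⟩
    | add x y hx hy =>
      obtain ⟨x', rfl⟩ := hx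
      obtain ⟨y', rfl⟩ := hy
      exact ⟨x' + y', map_add _ _ _⟩
    | single F p =>
      induction p using MvPolynomial.induction_on' with
      | monomial b c =>
        exact ⟨DirectSum.of (fun a => cellularGrading k K lab i a) _
          ⟨_, single_monomial_mem_cellularGrading lab F b c⟩, DirectSum.coeAddMonoidHom_of _ _ _⟩
      | add p q hp hq =>
        obtain ⟨x', hx⟩ := hp
        obtain ⟨y', hy⟩ := hq
        exact ⟨x' + y', by rw [map_add, hx, hy, Finsupp.single_add]⟩

lemma exists_homogeneous_basis : ∃ B : Set (CellularModule k n K i),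
    (∀ x ∈ B, ∃ a, x ∈ cellularGrading k K lab i a) ∧
    LinearIndependent (MvPolynomial (Fin n) k) (fun x : B => (x : CellularModule k n K i)) ∧
    Submodule.span (MvPolynomial (Fin n) k) B = ⊤ := by
  refine ⟨Set.range Finsupp.basisSingleOne, ?_,
    Finsupp.basisSingleOne.linearIndependent.linearIndepOn_id,
    Finsupp.basisSingleOne.span_eq⟩
  rintro _ ⟨F, rfl⟩
  refine ⟨0 + lcmLabel lab F.1, ?_⟩
  rw [Finsupp.coe_basisSingleOne]
  exact single_monomial_mem_cellularGrading lab F 0 1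

lemma cellularAugmentation_mem {a : Fin n →₀ ℕ} {x : CellularModule k n K 0}
    [Finite V] (ord : LinearOrder V)
    (hx : x ∈ cellularGrading k K lab 0 a) {b : Fin n →₀ ℕ}
    (hb : coeff b (cellularAugmentation k K lab x) ≠ 0) : b = a := by
  have : Fintype V := Fintype.ofFinite V
  by_contra hne
  rw [coeff_cellularAugmentation lab ord, (mem_cellularGrading_iff lab).1 hx b hne,
    chainBoundary_zero] at hb
  exact hb rfl

lemma range_cellularAugmentation : LinearMap.range (cellularAugmentation k K lab) =
    Ideal.span (Set.range fun v => monomial (lab v) (1 : k)) := by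
  rw [cellularAugmentation, Finsupp.range_linearCombination]
  refine congrArg _ (Set.ext fun p => ⟨?_, ?_⟩)
  · rintro ⟨F, rfl⟩
    obtain ⟨v, hv⟩ := Finset.card_eq_one.1 F.2.2
    exact ⟨v, by simp [hv, lcmLabel]⟩
  · rintro ⟨v, rfl⟩
    exact ⟨⟨{v}, K.singleton_mem v, by simp⟩, by simp [lcmLabel]⟩

end Grading

/-! ### The Buchberger complex -/

/-- A labelled simplicial complex whose subcomplexes of bounded multidegree are empty or acyclic
over `k` supports a resolution of the ideal generated by the labels. -/
theorem supportsCellularResolution_of_acyclic {k : Type*} [Field k] {n : ℕ} {V : Type*} [Fintype V]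
    {K : AbstractSimplicialComplex V} {lab : V → (Fin n →₀ ℕ)}
    (hK : ∀ (ord : LinearOrder V) (b : Fin n →₀ ℕ) (v : V), lab v ≤ b → ∀ c : Finset V → k,
      ChainSupported {F | lcmLabel lab F ≤ b ∧ (F.Nonempty → F ∈ K)} c → chainBoundary ord c = 0 →
      ∃ w : Finset V → k, ChainSupported {F | lcmLabel lab F ≤ b ∧ (F.Nonempty → F ∈ K)} w ∧
        chainBoundary ord w = c) :
    SupportsCellularResolution K lab
      (Ideal.span (Set.range fun v => monomial (lab v) (1 : k))) := by
  intro ord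
  refine
    { isInternal := fun i => isInternal_cellularGrading lab
      monomial_smul_mem := fun i a b c x hx => monomial_smul_mem_cellularGrading lab a b c x hx
      free := fun i => exists_homogeneous_basis lab
      d_mem := fun i a x hx => ?_
      ε_mem := fun a x hx b hb => cellularAugmentation_mem lab ord hx hb
      exact_succ := fun i y => ⟨fun hy => ?_, ?_⟩
      exact_zero := fun y => ⟨fun hy => ?_, ?_⟩
      range_ε := range_cellularAugmentation lab }
  · rw [mem_cellularGrading_iff] at hx ⊢
    intro b hb
    rw [strand_cellularDifferential, hx b hb, chainBoundary_zero]
  · refine exists_cellularDifferential_eq lab ord (hK ord) y fun b => ?_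
    rw [← strand_cellularDifferential, hy, map_zero]
  · rintro ⟨x, rfl⟩
    refine strand_ext lab fun b => ?_
    rw [strand_cellularDifferential, strand_cellularDifferential, chainBoundary_chainBoundary,
      map_zero]
  · refine exists_cellularDifferential_eq lab ord (hK ord) y fun b => ?_
    ext G
    by_cases hG : G = ∅
    · rw [hG, ← coeff_cellularAugmentation, hy]
      rfl
    · exact chainBoundary_strand_apply_of_card_ne lab ord y (by simpa using hG)
  · rintro ⟨x, rfl⟩
    ext b
    rw [coeff_cellularAugmentation lab ord, strand_cellularDifferential,
      chainBoundary_chainBoundary]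
    simp

lemma IsMonomialIdeal.eq_span_minGen {k : Type*} [Field k] {n : ℕ}
    {I : Ideal (MvPolynomial (Fin n) k)} (hI : IsMonomialIdeal I) :
    Ideal.span (Set.range fun v : minGen I => monomial v.1 (1 : k)) = I := by
  refine le_antisymm (Ideal.span_le.2 ?_) ?_
  · rintro _ ⟨v, rfl⟩
    exact v.2.1
  · obtain ⟨A, hA⟩ := hI
    conv_lhs => rw [hA]
    refine Ideal.span_le.2 ?_
    rintro _ ⟨a, ha, rfl⟩
    have haI : monomial a (1 : k) ∈ I := hA ▸ Ideal.subset_span ⟨a, ha, rfl⟩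
    obtain ⟨m, hma, hm⟩ := exists_minimal_le_of_wellFoundedLT
      (fun b => monomial b (1 : k) ∈ I) a haI
    have : monomial a (1 : k) = monomial (a - m) 1 * monomial m 1 := by
      rw [monomial_mul, tsub_add_cancel_of_le hma, mul_one]
    change monomial a (1 : k) ∈ _
    rw [this]
    exact Ideal.mul_mem_left _ _ (Ideal.subset_span ⟨⟨m, hm⟩, rfl⟩)

lemma mem_buchbergerComplex_iff {k : Type*} [Field k] {n : ℕ} {I : Ideal (MvPolynomial (Fin n) k)}
    {F : Finset (minGen I)} : F ∈ buchbergerComplex I ↔ F.Nonempty ∧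
      lcmLabel (fun v : minGen I => v.1) F ∉ properMultiples fun v : minGen I => v.1 := by
  change (_ ∧ _) ↔ _
  simp [properMultiples]

lemma geometricRealization_buchbergerComplex {k : Type*} [Field k] {n : ℕ}
    (I : Ideal (MvPolynomial (Fin n) k)) [Fintype (minGen I)] :
    geometricRealization (buchbergerComplex I) = realizationOf {F : Finset (minGen I) |
      lcmLabel (fun v : minGen I => v.1) F ∉ properMultiples fun v : minGen I => v.1} := by
  have hsum : ∀ (x : minGen I → ℝ) (F : Finset (minGen I)), (∀ v, v ∉ F → x v = 0) →
      ∑ v ∈ F, x v = ∑ v, x v := fun x F h =>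
    Finset.sum_subset (Finset.subset_univ F) fun v _ hv => h v hv
  ext x
  constructor
  · rintro ⟨hx, F, hF, hFx, h1⟩
    exact ⟨hx, hsum x F hFx ▸ h1, F, (mem_buchbergerComplex_iff.1 hF).2, hFx⟩
  · rintro ⟨hx, h1, F, hF, hFx⟩
    rw [← hsum x F hFx] at h1
    refine ⟨hx, F, mem_buchbergerComplex_iff.2 ⟨?_, hF⟩, hFx, h1⟩
    rw [Finset.nonempty_iff_ne_empty]
    rintro rfl
    simp at h1

theorem mainTheorem1 {k : Type*} [Field k] (n : ℕ) (I : Ideal (MvPolynomial (Fin n) k))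
    (hI : IsMonomialIdeal I) :
    (I ≠ ⊥ → ContractibleSpace (geometricRealization (buchbergerComplex I))) ∧
      SupportsCellularResolution (buchbergerComplex I) (fun v : minGen I => v.1) I := by
  have : Fintype (minGen I) := Fintype.ofFinite _
  constructor
  · intro h0
    have : Nonempty (minGen I) := by
      by_contra hne
      rw [not_nonempty_iff] at hne
      refine h0 ?_
      rw [← hI.eq_span_minGen, Set.range_eq_empty, Ideal.span_empty]
    rw [geometricRealization_buchbergerComplex]
    exact contractibleSpace_realizationOf _
  · have hK : {F : Finset (minGen I) | F.Nonempty → F ∈ buchbergerComplex I} =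
        {F | lcmLabel (fun v : minGen I => v.1) F ∉ properMultiples fun v : minGen I => v.1} := by
      ext F
      rcases F.eq_empty_or_nonempty with rfl | hF
      · simpa using fun ⟨u, hu⟩ => hu.ne_zero rfl
      · simp [mem_buchbergerComplex_iff, hF]
    have key := supportsCellularResolution_of_acyclic (k := k) (K := buchbergerComplex I)
      (lab := fun v : minGen I => v.1) fun ord b v hv c hc h0 => by
        have hset : {F : Finset (minGen I) | lcmLabel (fun v : minGen I => v.1) F ≤ b ∧
            (F.Nonempty → F ∈ buchbergerComplex I)} =
            {F | lcmLabel (fun v : minGen I => v.1) F ≤ b ∧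
            lcmLabel (fun v : minGen I => v.1) F ∉ properMultiples fun v : minGen I => v.1} := by
          ext F
          exact and_congr_right' (Set.ext_iff.1 hK F)
        rw [hset] at hc ⊢
        exact exists_chainBoundary_eq ord _ hv hc h0
    rwa [hI.eq_span_minGen] at key
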